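/- Let $\zeta$ be the Riemann zeta function and $\mathrm{Li}_m(z)=\sum_{n\ge 1} z^n/n^m$ the polylogarithm, and write $\ln(x)^k$ for $(\ln x)^k$. The following ten integrals converge absolutely and have the stated values: \begin{align*} &\int_0^\infty \tfrac14\ln(1+e^{-u})\,du=\frac{\pi^2}{48},\\ &\int_0^\infty u\ln(1+e^{-u})\,du=\tfrac34\zeta(3),\\ &\int_0^\infty \ln(1+e^{-u})^2\,du=\frac{\zeta(3)}4,\\ &\int_0^\infty \frac{u^3e^{-u}}{1+e^{-u}}\,du=\frac{7\pi^4}{120},\\ &\int_0^\infty \ln(1+e^{-u})^3\,du=\tfrac14\pi^2\ln(2)^2-\tfrac{21}4\ln(2)\zeta(3)-6\,\mathrm{Li}_4(\tfrac12)+\tfrac1{15}\pi^4-\tfrac14\ln(2)^4,\\ &\int_0^\infty u\ln(1+e^{-u})^2\,du=4\,\mathrm{Li}_4(\tfrac12)-\tfrac1{24}\pi^4-\tfrac16\pi^2\ln(2)^2+\tfrac16\ln(2)^4+\tfrac72\ln(2)\zeta(3),\\ &\int_0^\infty \frac{u^4e^{-u}}{1+e^{-u}}\,du=\tfrac{45}2\zeta(5),\\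 &\int_0^\infty u\ln(1+e^{-u})^3\,du=12\,\mathrm{Li}_5(\tfrac12)+12\ln(2)\mathrm{Li}_4(\tfrac12)+\tfrac25\ln(2)^5+\tfrac{21}4\zeta(3)\ln(2)^2-\tfrac{99}{16}\zeta(5)-\tfrac13\pi^2\ln(2)^3-\tfrac12\zeta(3)\pi^2,\\ &\int_0^\infty \frac{u^3e^{-u}\ln(1+e^{-u})}{1+e^{-u}}\,du=-\tfrac{87}{16}\zeta(5)+\tfrac12\pi^2\zeta(3),\\ &\int_0^\infty \ln(1+e^{-u})^4\,du=\tfrac23\pi^2\ln(2)^3-\tfrac{21}2\ln(2)^2\zeta(3)-24\ln(2)\mathrm{Li}_4(\tfrac12)-\tfrac45\ln(2)^5-24\,\mathrm{Li}_5(\tfrac12)+24\zeta(5). \end{align*} -/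

import Mathlib

/-- The polylogarithm `Li_m(z) = ∑_{n ≥ 1} z ^ n / n ^ m` of integer order, for real `z`. -/
noncomputable def polylog (m : ℕ) (z : ℝ) : ℝ :=
  ∑' n : ℕ, z ^ (n + 1) / ((n : ℝ) + 1) ^ m

/-- The defining series of `Li_m(z)` converges for `|z| < 1`. -/
theorem hasSum_polylog (m : ℕ) {z : ℝ} (hz : |z| < 1) :
    HasSum (fun n : ℕ => z ^ (n + 1) / ((n : ℝ) + 1) ^ m) (polylog m z) := by
  refine Summable.hasSum ?_
  refine Summable.of_norm_bounded (g := fun n : ℕ => |z| ^ (n + 1))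
    ((summable_nat_add_iff 1).2 (summable_geometric_of_lt_one (abs_nonneg z) hz)) fun n => ?_
  rw [Real.norm_eq_abs, abs_div, abs_pow, abs_pow, abs_of_nonneg (by positivity : (0 : ℝ) ≤ n + 1)]
  exact div_le_self (by positivity) (one_le_pow₀ (by linarith [Nat.cast_nonneg (α := ℝ) n]))

/-- The value of the Riemann zeta function at a natural number, as a real number. -/
noncomputable def zetaR (k : ℕ) : ℝ := (riemannZeta k).re

/-- For `k ≥ 2` no information is lost in `zetaR`: the value `ζ(k)` is real. -/
theorem zetaR_eq {k : ℕ} (hk : 1 < k) : (zetaR k : ℂ) = riemannZeta k := by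
  have h : riemannZeta k = ((∑' n : ℕ, 1 / (n : ℝ) ^ k : ℝ) : ℂ) := by
    rw [zeta_nat_eq_tsum_of_gt_one hk, Complex.ofReal_tsum]
    simp
  rw [zetaR, h, Complex.ofReal_re]

/-- `∫₀^∞ f(u) du` exists as a Lebesgue integral and is equal to `a`. -/
def HasHalfLineIntegral (f : ℝ → ℝ) (a : ℝ) : Prop :=
  MeasureTheory.IntegrableOn f (Set.Ioi 0) ∧ ∫ u in Set.Ioi (0 : ℝ), f u = a

/-!
Put `ℓ u = log (1 + exp (-u))`. All ten integrals reduce, up to an integration by parts, to the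
moments `M(a, b) = ∫₀^∞ u ^ b * ℓ u ^ a du`. The pair `x = ℓ u`, `y = ℓ (-u) = u + ℓ u` parametrises
the curve `exp (-x) + exp (-y) = 1`, and this symmetry yields the linear relations between moments:

* expanding `ℓ` in powers of `exp (-u)` evaluates `M(1, b)`;
* substituting `t = ℓ u` in the Bose integral `∫₀^∞ t ^ a / (exp t - 1) dt = a! ζ(a + 1)` produces
  `M(a, 0)` up to integrals with explicit primitives, whose boundary terms at `u = 0`, where
  `x = y = log 2`, are polylogarithms at `1/2`;
* integrating the derivative of `y ^ (a + 1) - u ^ (a + 1)`, a polynomial in `u` and `x`, gives one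
  relation between the moments with `a + b` fixed;
* the same substitution in `∫₀^∞ -t ^ k * log (1 - exp (-t)) / (1 - exp (-t)) dt`, which equals
  `k! (ζ(k + 2) + ζ(k + 1, 1))`, gives a second one.

For `a + b = 4` these suffice once Euler's evaluation `ζ(4, 1) = 2 ζ(5) - ζ(2) ζ(3)` is known. The
latter comes from `∑ₚ,ᵩ 1 / (p ^ (m + 1) * q * (p + q))`: summing over `q` first gives harmonic
numbers, while partial fractions give double zeta values, whence `∑ ζ(i + 2, j + 1) = ζ(m + 3)` over
`i + j = m`. The products `ζ(a) ζ(b) = ζ(a + b) + ζ(a, b) + ζ(b, a)` eliminate the terms with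
`j ≠ 0`.
-/

open Real MeasureTheory Set Filter Topology

/-! ### Integrals over the half-line -/

theorem integral_pow_mul_exp_neg_mul_Ioi (k : ℕ) {r : ℝ} (hr : 0 < r) :
    ∫ u in Ioi (0 : ℝ), u ^ k * exp (-(r * u)) = k.factorial / r ^ (k + 1) := by
  have h := integral_rpow_mul_exp_neg_mul_Ioi (a := k + 1) (by positivity) hr
  rw [Gamma_nat_eq_factorial, ← Nat.cast_add_one, rpow_natCast, one_div, inv_pow] at h
  rw [div_eq_inv_mul, ← h]
  refine setIntegral_congr_fun measurableSet_Ioi fun u _ => ?_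
  simp [← rpow_natCast]

theorem integrableOn_pow_mul_exp_neg_mul_Ioi (k : ℕ) {r : ℝ} (hr : 0 < r) :
    IntegrableOn (fun u : ℝ => u ^ k * exp (-(r * u))) (Ioi 0) :=
  not_imp_comm.1 integral_undef <| by
    rw [integral_pow_mul_exp_neg_mul_Ioi k hr]
    positivity

theorem integrable_of_hasSum_of_summable_integral_norm {α ι E : Type*} [MeasurableSpace α]
    [NormedAddCommGroup E] {μ : Measure α} [Countable ι] {F : ι → α → E} {G : α → E}
    (hF : ∀ i, Integrable (F i) μ) (hs : Summable fun i => ∫ a, ‖F i a‖ ∂μ)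
    (hG : ∀ᵐ a ∂μ, HasSum (fun i => F i a) (G a)) : Integrable G μ := by
  have hmeas : AEStronglyMeasurable G μ :=
    aestronglyMeasurable_of_tendsto_ae atTop
      (fun s => Finset.aestronglyMeasurable_fun_sum s fun i _ => (hF i).aestronglyMeasurable) hG
  refine ⟨hmeas, ?_⟩
  calc ∫⁻ a, ‖G a‖ₑ ∂μ
      ≤ ∫⁻ a, ∑' i, ‖F i a‖ₑ ∂μ := by
        refine lintegral_mono_ae (hG.mono fun a h => ?_)
        rw [← h.tsum_eq]
        exact enorm_tsum_le_tsum_enorm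
    _ = ENNReal.ofReal (∑' i, ∫ a, ‖F i a‖ ∂μ) := by
        rw [lintegral_tsum fun i => (hF i).aestronglyMeasurable.enorm,
          ENNReal.ofReal_tsum_of_nonneg (fun i => integral_nonneg fun a => norm_nonneg _) hs]
        simp_rw [ofReal_integral_norm_eq_lintegral_enorm (hF _)]
    _ < ⊤ := ENNReal.ofReal_lt_top

/-- `hasSum_mellin` does not assert integrability, which is part of `HasHalfLineIntegral`. -/
theorem hasHalfLineIntegral_pow_mul_of_hasSum {ι : Type*} [Countable ι] (k : ℕ) {c r : ι → ℝ}
    (hr : ∀ i, 0 < r i) {F : ℝ → ℝ} {s : ℝ}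
    (habs : Summable fun i => |c i| / r i ^ (k + 1)) (hs : HasSum (fun i => c i / r i ^ (k + 1)) s)
    (hF : ∀ u, 0 < u → HasSum (fun i => c i * exp (-(r i * u))) (F u)) :
    HasHalfLineIntegral (fun u => u ^ k * F u) (k.factorial * s) := by
  set f : ι → ℝ → ℝ := fun i u => c i * (u ^ k * exp (-(r i * u))) with hf
  have hint i : IntegrableOn (f i) (Ioi 0) :=
    (integrableOn_pow_mul_exp_neg_mul_Ioi k (hr i)).const_mul _
  have hval i : ∫ u in Ioi (0 : ℝ), f i u = k.factorial * (c i / r i ^ (k + 1)) := by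
    rw [integral_const_mul, integral_pow_mul_exp_neg_mul_Ioi k (hr i), mul_div_left_comm]
  have hnorm i : ∫ u in Ioi (0 : ℝ), ‖f i u‖ = k.factorial * (|c i| / r i ^ (k + 1)) := by
    rw [mul_div_left_comm, ← integral_pow_mul_exp_neg_mul_Ioi k (hr i), ← integral_const_mul]
    refine setIntegral_congr_fun measurableSet_Ioi fun u (hu : 0 < u) => ?_
    simp only [hf, norm_mul, norm_eq_abs, abs_exp, abs_pow, abs_of_pos hu]
  have hsum : Summable fun i => ∫ u in Ioi (0 : ℝ), ‖f i u‖ := by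
    simp_rw [hnorm]
    exact habs.mul_left _
  have hae : ∀ᵐ u ∂(volume.restrict (Ioi (0 : ℝ))), HasSum (fun i => f i u) (u ^ k * F u) :=
    ae_restrict_of_forall_mem measurableSet_Ioi fun u hu =>
      ((hF u hu).mul_left (u ^ k)).congr_fun fun i => mul_left_comm _ _ _
  refine ⟨integrable_of_hasSum_of_summable_integral_norm hint hsum hae, ?_⟩
  have h := hasSum_integral_of_summable_integral_norm hint hsum
  rw [integral_congr_ae (hae.mono fun u h => h.tsum_eq)] at h
  exact h.unique ((hs.mul_left _).congr_fun hval)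

namespace HasHalfLineIntegral

variable {f g : ℝ → ℝ} {a b : ℝ}

theorem congr (hf : HasHalfLineIntegral f a) (h : ∀ u, 0 < u → f u = g u) :
    HasHalfLineIntegral g a :=
  ⟨hf.1.congr_fun h measurableSet_Ioi, by rw [← hf.2, setIntegral_congr_fun measurableSet_Ioi h]⟩

theorem add (hf : HasHalfLineIntegral f a) (hg : HasHalfLineIntegral g b) :
    HasHalfLineIntegral (fun u => f u + g u) (a + b) :=
  ⟨hf.1.add hg.1, by rw [integral_add hf.1 hg.1, hf.2, hg.2]⟩

theorem sub (hf : HasHalfLineIntegral f a) (hg : HasHalfLineIntegral g b) :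
    HasHalfLineIntegral (fun u => f u - g u) (a - b) :=
  ⟨hf.1.sub hg.1, by rw [integral_sub hf.1 hg.1, hf.2, hg.2]⟩

theorem const_mul (hf : HasHalfLineIntegral f a) (c : ℝ) :
    HasHalfLineIntegral (fun u => c * f u) (c * a) :=
  ⟨hf.1.const_mul c, by rw [integral_const_mul, hf.2]⟩

theorem sum {ι : Type*} {s : Finset ι} {f : ι → ℝ → ℝ} {a : ι → ℝ}
    (h : ∀ i ∈ s, HasHalfLineIntegral (f i) (a i)) :
    HasHalfLineIntegral (fun u => ∑ i ∈ s, f i u) (∑ i ∈ s, a i) :=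
  ⟨integrable_finsetSum _ fun i hi => (h i hi).1, by
    rw [integral_finsetSum _ fun i hi => (h i hi).1]
    exact Finset.sum_congr rfl fun i hi => (h i hi).2⟩

theorem unique (ha : HasHalfLineIntegral f a) (hb : HasHalfLineIntegral f b) : a = b :=
  ha.2.symm.trans hb.2

theorem of_hasDerivAt {F : ℝ → ℝ} {l : ℝ} (hF : ∀ u, HasDerivAt F (f u) u)
    (hf : IntegrableOn f (Ioi 0)) (hl : Tendsto F atTop (𝓝 l)) :
    HasHalfLineIntegral f (l - F 0) :=
  ⟨hf, integral_Ioi_of_hasDerivAt_of_tendsto' (fun u _ => hF u) hf hl⟩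

theorem of_hasDerivAt_of_nonneg {F : ℝ → ℝ} {l : ℝ} (hF : ∀ u, HasDerivAt F (f u) u)
    (hf : ∀ u, 0 < u → 0 ≤ f u) (hl : Tendsto F atTop (𝓝 l)) :
    HasHalfLineIntegral f (l - F 0) :=
  of_hasDerivAt hF (integrableOn_Ioi_deriv_of_nonneg' (fun u _ => hF u) hf hl) hl

end HasHalfLineIntegral

theorem integrableOn_pow_mul_of_abs_le_exp_neg (k : ℕ) {f : ℝ → ℝ} (hf : Continuous f)
    (hle : ∀ u, 0 < u → |f u| ≤ exp (-u)) : IntegrableOn (fun u => u ^ k * f u) (Ioi 0) := by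
  refine (integrableOn_pow_mul_exp_neg_mul_Ioi k one_pos).mono' (by fun_prop)
    (ae_restrict_of_forall_mem measurableSet_Ioi fun u (hu : 0 < u) => ?_)
  rw [norm_mul, norm_pow, norm_of_nonneg hu.le, one_mul]
  exact mul_le_mul_of_nonneg_left (hle u hu) (by positivity)

/-! ### The function `log (1 + exp (-u))` and its moments -/

/-- The softplus function of `-u`, that is `-log ∘ sigmoid`, whose powers are integrated. -/
noncomputable def logOneAddExpNeg (u : ℝ) : ℝ := log (1 + exp (-u))

local notation "ℓ" => logOneAddExpNeg

theorem logOneAddExpNeg_pos (u : ℝ) : 0 < ℓ u := log_pos (by linarith [exp_pos (-u)])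

theorem logOneAddExpNeg_le (u : ℝ) : ℓ u ≤ exp (-u) :=
  (log_le_sub_one_of_pos (by positivity)).trans (by simp)

theorem logOneAddExpNeg_zero : ℓ 0 = log 2 := by norm_num [logOneAddExpNeg]

theorem exp_neg_logOneAddExpNeg (u : ℝ) : exp (-ℓ u) = sigmoid u := by
  rw [sigmoid_def, exp_neg, logOneAddExpNeg, exp_log (by positivity)]

theorem logOneAddExpNeg_neg (u : ℝ) : ℓ (-u) = u + ℓ u := by
  have h : exp (-(u + ℓ u)) = exp (-ℓ (-u)) := by
    rw [neg_add, exp_add, exp_neg_logOneAddExpNeg, exp_neg_logOneAddExpNeg, mul_comm,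
      sigmoid_mul_rexp_neg]
  exact (neg_injective (exp_injective h)).symm

theorem hasDerivAt_logOneAddExpNeg (u : ℝ) : HasDerivAt ℓ (-sigmoid (-u)) u := by
  have h : HasDerivAt (fun u : ℝ => 1 + exp (-u)) (-exp (-u)) u := by
    simpa using ((hasDerivAt_neg u).exp).const_add 1
  refine (h.log (by positivity)).congr_deriv ?_
  rw [← sigmoid_mul_rexp_neg, sigmoid_def, neg_div, div_eq_inv_mul]

theorem hasDerivAt_logOneAddExpNeg_neg (u : ℝ) :
    HasDerivAt (fun u => ℓ (-u)) (sigmoid u) u := by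
  simpa [Function.comp_def] using! (hasDerivAt_logOneAddExpNeg (-u)).scomp u (hasDerivAt_neg u)

@[fun_prop]
theorem continuous_logOneAddExpNeg : Continuous ℓ :=
  continuous_iff_continuousAt.2 fun u => (hasDerivAt_logOneAddExpNeg u).continuousAt

theorem strictAnti_logOneAddExpNeg : StrictAnti ℓ :=
  strictAnti_of_hasDerivAt_neg hasDerivAt_logOneAddExpNeg fun _ => neg_neg_of_pos (sigmoid_pos _)

theorem range_logOneAddExpNeg : range ℓ = Ioi 0 := by
  refine Subset.antisymm (range_subset_iff.2 logOneAddExpNeg_pos) fun t (ht : 0 < t) => ?_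
  have h : 0 < exp t - 1 := sub_pos.2 (one_lt_exp_iff.2 ht)
  exact ⟨-log (exp t - 1), by
    rw [logOneAddExpNeg, neg_neg, exp_log h, add_sub_cancel, log_exp]⟩

theorem logOneAddExpNeg_pow_le_one (a : ℕ) {u : ℝ} (hu : 0 ≤ u) : ℓ u ^ a ≤ 1 :=
  pow_le_one₀ (logOneAddExpNeg_pos u).le
    ((logOneAddExpNeg_le u).trans (exp_le_one_iff.2 (neg_nonpos.2 hu)))

theorem logOneAddExpNeg_pow_le {a : ℕ} (ha : a ≠ 0) {u : ℝ} (hu : 0 ≤ u) :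
    ℓ u ^ a ≤ exp (-u) := by
  obtain ⟨n, rfl⟩ := Nat.exists_eq_succ_of_ne_zero ha
  rw [pow_succ]
  exact (mul_le_of_le_one_left (logOneAddExpNeg_pos u).le (logOneAddExpNeg_pow_le_one n hu)).trans
    (logOneAddExpNeg_le u)

theorem tendsto_pow_mul_logOneAddExpNeg_pow (b : ℕ) {a : ℕ} (ha : a ≠ 0) :
    Tendsto (fun u => u ^ b * ℓ u ^ a) atTop (𝓝 0) := by
  refine squeeze_zero' ?_ ?_ (tendsto_pow_mul_exp_neg_atTop_nhds_zero b)
  all_goals filter_upwards [eventually_ge_atTop 0] with u hu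
  · have := logOneAddExpNeg_pos u
    positivity
  · exact mul_le_mul_of_nonneg_left (logOneAddExpNeg_pow_le ha hu) (by positivity)

/-- The moments `∫₀^∞ u ^ b * log (1 + exp (-u)) ^ a du`, in which all the integrals of the theorem
are expressed. They diverge (and take the junk value `0`) when `a = 0`. -/
noncomputable def logMoment (a b : ℕ) : ℝ := ∫ u in Ioi (0 : ℝ), u ^ b * ℓ u ^ a

theorem hasHalfLineIntegral_logMoment {a : ℕ} (ha : a ≠ 0) (b : ℕ) :
    HasHalfLineIntegral (fun u => u ^ b * ℓ u ^ a) (logMoment a b) := by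
  refine ⟨integrableOn_pow_mul_of_abs_le_exp_neg b (by fun_prop) fun u hu => ?_, rfl⟩
  rw [abs_of_pos (pow_pos (logOneAddExpNeg_pos u) a)]
  exact logOneAddExpNeg_pow_le ha hu.le

theorem hasHalfLineIntegral_pow_mul_logOneAddExpNeg_pow_mul_sigmoid_neg (a b : ℕ) :
    HasHalfLineIntegral (fun u => u ^ (b + 1) * (ℓ u ^ a * sigmoid (-u)))
      ((b + 1) / (a + 1) * logMoment (a + 1) b) := by
  have hint : IntegrableOn (fun u => u ^ (b + 1) * (ℓ u ^ a * sigmoid (-u))) (Ioi 0) := by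
    refine integrableOn_pow_mul_of_abs_le_exp_neg (b + 1) (by fun_prop) fun u hu => ?_
    have hℓ := pow_pos (logOneAddExpNeg_pos u) a
    rw [abs_of_nonneg (mul_nonneg hℓ.le (sigmoid_nonneg _)), ← sigmoid_mul_rexp_neg]
    exact (mul_le_of_le_one_left (mul_nonneg (sigmoid_nonneg u) (exp_pos _).le)
      (logOneAddExpNeg_pow_le_one a hu.le)).trans
        (mul_le_of_le_one_left (exp_pos _).le (sigmoid_le_one u))
  have hmoment := (hasHalfLineIntegral_logMoment a.succ_ne_zero b).const_mul ((b + 1) / (a + 1))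
  have hparts := HasHalfLineIntegral.of_hasDerivAt (l := 0)
    (F := fun u => u ^ (b + 1) * ℓ u ^ (a + 1) / (a + 1)) (fun u => ?_) (hmoment.1.sub hint) ?_
  · simpa using hmoment.sub hparts
  · refine (((hasDerivAt_pow (b + 1) u).mul
      ((hasDerivAt_logOneAddExpNeg u).pow (a + 1))).div_const _).congr_deriv ?_
    simp only [Nat.cast_add, Nat.cast_one, add_tsub_cancel_right, Pi.pow_apply, Pi.sub_apply,
      mul_neg, Nat.succ_eq_add_one]
    field
  · simpa using (tendsto_pow_mul_logOneAddExpNeg_pow (b + 1) a.succ_ne_zero).div_const (a + 1 : ℝ)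

/-- The substitution `t = ℓ u` maps `ℝ` onto the half-line; the negative `u` are folded back. -/
theorem HasHalfLineIntegral.comp_logOneAddExpNeg {g : ℝ → ℝ} {s : ℝ}
    (hg : HasHalfLineIntegral g s) :
    HasHalfLineIntegral (fun u => g (ℓ u) * sigmoid (-u) + g (ℓ (-u)) * sigmoid u) s := by
  have hderiv : ∀ u ∈ (univ : Set ℝ), HasDerivWithinAt ℓ (-sigmoid (-u)) univ u := fun u _ =>
    (hasDerivAt_logOneAddExpNeg u).hasDerivWithinAt
  have hinj : InjOn ℓ univ := strictAnti_logOneAddExpNeg.injective.injOn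
  have himage : ℓ '' univ = Ioi 0 := by rw [image_univ, range_logOneAddExpNeg]
  have habs : (fun u => |-sigmoid (-u)| • g (ℓ u)) = fun u => g (ℓ u) * sigmoid (-u) := by
    ext u
    rw [abs_neg, abs_of_pos (sigmoid_pos _), smul_eq_mul, mul_comm]
  have hint := integrableOn_image_iff_integrableOn_abs_deriv_smul MeasurableSet.univ hderiv hinj g
  have hval := integral_image_eq_integral_abs_deriv_smul MeasurableSet.univ hderiv hinj g
  rw [himage, habs, integrableOn_univ] at hint
  rw [himage, habs, setIntegral_univ, hg.2] at hval
  have hpos : Integrable fun u => g (ℓ u) * sigmoid (-u) := hint.1 hg.1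
  have hneg : Integrable fun u => g (ℓ (-u)) * sigmoid u := by simpa using hpos.comp_neg
  refine ⟨hpos.integrableOn.add hneg.integrableOn, ?_⟩
  have hfold := integral_comp_neg_Ioi 0 fun u => g (ℓ u) * sigmoid (-u)
  simp only [neg_neg, neg_zero] at hfold
  rw [integral_add hpos.integrableOn hneg.integrableOn, hfold, add_comm,
    intervalIntegral.integral_Iic_add_Ioi hpos.integrableOn hpos.integrableOn, hval]

/-! ### Zeta values and polylogarithms -/

theorem hasSum_zetaR {k : ℕ} (hk : 1 < k) :
    HasSum (fun n : ℕ => 1 / ((n : ℝ) + 1) ^ k) (zetaR k) := by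
  have hs : Summable fun n : ℕ => 1 / (n : ℝ) ^ k := summable_one_div_nat_pow.2 hk
  have h : zetaR k = ∑' n : ℕ, 1 / (n : ℝ) ^ k := by
    rw [← Complex.ofReal_inj, zetaR_eq hk, zeta_nat_eq_tsum_of_gt_one hk, Complex.ofReal_tsum]
    simp
  simpa [h, show k ≠ 0 by omega] using (hasSum_nat_add_iff' 1).2 hs.hasSum

theorem zetaR_eq_of_hasSum {k : ℕ} (hk : 1 < k) {s : ℝ}
    (h : HasSum (fun n : ℕ => 1 / (n : ℝ) ^ k) s) : zetaR k = s := by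
  refine (hasSum_zetaR hk).unique ?_
  simpa [show k ≠ 0 by omega] using (hasSum_nat_add_iff' 1).2 h

theorem zetaR_two : zetaR 2 = π ^ 2 / 6 := zetaR_eq_of_hasSum one_lt_two hasSum_zeta_two

theorem zetaR_four : zetaR 4 = π ^ 4 / 90 := zetaR_eq_of_hasSum (by norm_num) hasSum_zeta_four

theorem hasSum_polylog_of_abs_le_one {k : ℕ} (hk : 1 < k) {z : ℝ} (hz : |z| ≤ 1) :
    HasSum (fun n : ℕ => z ^ (n + 1) / ((n : ℝ) + 1) ^ k) (polylog k z) := by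
  refine (Summable.of_norm_bounded (hasSum_zetaR hk).summable fun n => ?_).hasSum
  rw [norm_div, norm_pow, norm_of_nonneg (by positivity : (0 : ℝ) ≤ ((n : ℝ) + 1) ^ k)]
  gcongr
  exact pow_le_one₀ (norm_nonneg z) hz

theorem polylog_one_right {k : ℕ} (hk : 1 < k) : polylog k 1 = zetaR k := by
  simpa [polylog] using (hasSum_zetaR hk).tsum_eq

theorem polylog_add_polylog_neg {k : ℕ} (hk : 1 < k) {z : ℝ} (hz : |z| ≤ 1) :
    polylog k z + polylog k (-z) = 2 / 2 ^ k * polylog k (z ^ 2) := by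
  have hsum := (hasSum_polylog_of_abs_le_one hk hz).add
    (hasSum_polylog_of_abs_le_one hk (z := -z) (by rwa [abs_neg]))
  have hsq := (hasSum_polylog_of_abs_le_one hk (z := z ^ 2)
    (by rw [abs_pow]; exact pow_le_one₀ (abs_nonneg z) hz)).mul_left (2 / 2 ^ k)
  have hinj : Function.Injective fun n : ℕ => 2 * n + 1 := fun m n h => by simpa using h
  refine hsum.unique ((hinj.hasSum_iff fun n hn => ?_).1 (hsq.congr_fun fun n => ?_))
  · have hodd : Odd (n + 1) := by
      rw [Nat.odd_add_one, Nat.not_odd_iff_even, Nat.even_iff]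
      by_contra hn'
      exact hn ⟨n / 2, by dsimp only; omega⟩
    rw [hodd.neg_pow]
    ring
  · have heven : Even (2 * n + 1 + 1) := ⟨n + 1, by ring⟩
    simp only [Function.comp_apply, heven.neg_pow]
    push_cast
    rw [show (2 * (n : ℝ) + 1 + 1) = 2 * (n + 1) by ring, mul_pow]
    field

theorem polylog_neg_one {k : ℕ} (hk : 1 < k) : polylog k (-1) = -((1 - 2 / 2 ^ k) * zetaR k) := by
  have h := polylog_add_polylog_neg hk (z := 1) (by simp)
  rw [one_pow, polylog_one_right hk] at h
  linarith

theorem polylog_zero {z : ℝ} (hz : |z| < 1) : polylog 0 z = z / (1 - z) := by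
  simpa [polylog, pow_succ', tsum_mul_left, div_eq_mul_inv] using
    congrArg (z * ·) (tsum_geometric_of_abs_lt_one hz)

theorem polylog_one {z : ℝ} (hz : |z| < 1) : polylog 1 z = -log (1 - z) := by
  simpa [polylog] using (hasSum_pow_div_log_of_abs_lt_one hz).tsum_eq

theorem polylog_nonneg (k : ℕ) {z : ℝ} (hz : 0 ≤ z) : 0 ≤ polylog k z :=
  tsum_nonneg fun n => by positivity

theorem polylog_le_polylog_zero (k : ℕ) {z : ℝ} (hz : 0 ≤ z) (hz1 : z < 1) :
    polylog k z ≤ polylog 0 z := by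
  have hz' : |z| < 1 := by rwa [abs_of_nonneg hz]
  refine hasSum_le (fun n => ?_) (hasSum_polylog k hz') (hasSum_polylog 0 hz')
  rw [pow_zero, div_one]
  exact div_le_self (by positivity) (one_le_pow₀ (by simp))

theorem hasDerivAt_polylog_succ (m : ℕ) {z : ℝ} (hz : |z| < 1) (hz0 : z ≠ 0) :
    HasDerivAt (polylog (m + 1)) (polylog m z / z) z := by
  obtain ⟨r, hzr, hr1⟩ := exists_between hz
  have hr0 : 0 ≤ r := (abs_nonneg z).trans hzr.le
  have hmem : z ∈ Ioo (-r) r := abs_lt.1 hzr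
  have h := hasDerivAt_tsum_of_isPreconnected (u := fun n : ℕ => r ^ n)
    (g := fun n z => z ^ (n + 1) / ((n : ℝ) + 1) ^ (m + 1))
    (g' := fun n z => z ^ n / ((n : ℝ) + 1) ^ m)
    (summable_geometric_of_lt_one hr0 hr1) isOpen_Ioo isPreconnected_Ioo
    (fun n y _ => ?_) (fun n y hy => ?_) hmem (hasSum_polylog (m + 1) hz).summable hmem
  · refine h.congr_deriv ?_
    rw [polylog, ← tsum_div_const]
    exact tsum_congr fun n => by field
  · refine ((hasDerivAt_pow (n + 1) y).div_const _).congr_deriv ?_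
    push_cast
    field
  · rw [norm_div, norm_pow, norm_pow, norm_of_nonneg (by positivity : (0 : ℝ) ≤ n + 1)]
    refine (div_le_self (by positivity) (one_le_pow₀ (by simp))).trans ?_
    exact pow_le_pow_left₀ (abs_nonneg _) (abs_lt.2 hy).le _

theorem abs_exp_neg_lt_one {t : ℝ} (ht : 0 < t) : |exp (-t)| < 1 := by
  rw [abs_exp, exp_lt_one_iff]
  exact neg_lt_zero.2 ht

theorem hasDerivAt_polylog_exp_neg (m : ℕ) {t : ℝ} (ht : 0 < t) :
    HasDerivAt (fun t => polylog (m + 1) (exp (-t))) (-polylog m (exp (-t))) t := by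
  refine ((hasDerivAt_polylog_succ m (abs_exp_neg_lt_one ht) (exp_ne_zero _)).comp t
    (hasDerivAt_neg t).exp).congr_deriv ?_
  field

theorem hasHalfLineIntegral_pow_mul_polylog {m k : ℕ} (hmk : m + k ≠ 0) {z : ℝ} (hz : |z| ≤ 1) :
    HasHalfLineIntegral (fun t => t ^ k * polylog m (z * exp (-t)))
      (k.factorial * polylog (m + k + 1) z) := by
  have hterm (w : ℝ) (n : ℕ) : w ^ (n + 1) / ((n : ℝ) + 1) ^ m / ((n : ℝ) + 1) ^ (k + 1) =
      w ^ (n + 1) / ((n : ℝ) + 1) ^ (m + k + 1) := by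
    rw [div_div, ← pow_add, ← add_assoc]
  have hsum (w : ℝ) (hw : |w| ≤ 1) := (hasSum_polylog_of_abs_le_one (by omega) hw).congr_fun
    (hterm w)
  refine hasHalfLineIntegral_pow_mul_of_hasSum k (r := fun n : ℕ => (n : ℝ) + 1)
    (fun n => by positivity) ?_ (hsum z hz) fun t ht => ?_
  · refine (hsum |z| (by rwa [abs_abs])).summable.congr fun n => ?_
    rw [abs_div, abs_pow, abs_of_nonneg (by positivity : (0 : ℝ) ≤ ((n : ℝ) + 1) ^ m)]
  · have habs : |z * exp (-t)| < 1 := by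
      rw [abs_mul]
      exact mul_lt_one_of_nonneg_of_lt_one_right hz (abs_nonneg _) (abs_exp_neg_lt_one ht)
    refine (hasSum_polylog m habs).congr_fun fun n => ?_
    rw [mul_pow, ← exp_nat_mul]
    push_cast
    ring_nf

theorem hasHalfLineIntegral_pow_mul_polylog_zero {k : ℕ} (hk : k ≠ 0) :
    HasHalfLineIntegral (fun t => t ^ k * polylog 0 (exp (-t))) (k.factorial * zetaR (k + 1)) := by
  simpa [polylog_one_right (show 1 < k + 1 by omega)] using
    hasHalfLineIntegral_pow_mul_polylog (m := 0) (k := k) (z := 1) (by omega) (by simp)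

/-- The closed form of `∫ s in Ioi t, s ^ a / (exp s - 1)` for `0 < t`, as obtained by integrating
by parts `a` times. -/
noncomputable def incompleteBose (a : ℕ) (t : ℝ) : ℝ :=
  ∑ j ∈ Finset.range (a + 1), a.descFactorial j * t ^ (a - j) * polylog (j + 1) (exp (-t))

theorem hasDerivAt_incompleteBose (a : ℕ) {t : ℝ} (ht : 0 < t) :
    HasDerivAt (incompleteBose a) (-(t ^ a * polylog 0 (exp (-t)))) t := by
  set T : ℕ → ℝ := fun j => a.descFactorial j * t ^ (a - j) * polylog j (exp (-t)) with hT
  have hterm : ∀ j ∈ Finset.range (a + 1), HasDerivAt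
      (fun t => a.descFactorial j * t ^ (a - j) * polylog (j + 1) (exp (-t))) (T (j + 1) - T j) t :=
    fun j _ => by
      refine (((hasDerivAt_pow (a - j) t).const_mul _).mul
        (hasDerivAt_polylog_exp_neg j ht)).congr_deriv ?_
      simp only [hT, Nat.descFactorial_succ, Nat.cast_mul, Nat.sub_sub]
      ring
  refine (HasDerivAt.fun_sum hterm).congr_deriv ?_
  rw [Finset.sum_range_sub]
  simp [hT]

theorem tendsto_pow_mul_polylog_exp_neg (n k : ℕ) :
    Tendsto (fun t => t ^ n * polylog k (exp (-t))) atTop (𝓝 0) := by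
  have hbound : Tendsto (fun t => t ^ n * exp (-t) / (1 - exp (-t))) atTop (𝓝 0) := by
    simpa using! (tendsto_pow_mul_exp_neg_atTop_nhds_zero n).div
      (tendsto_exp_neg_atTop_nhds_zero.const_sub 1) (by norm_num)
  refine squeeze_zero' ?_ ?_ hbound
  all_goals filter_upwards [eventually_gt_atTop 0] with t ht
  · exact mul_nonneg (by positivity) (polylog_nonneg k (exp_pos _).le)
  · rw [mul_div_assoc, ← polylog_zero (abs_exp_neg_lt_one ht)]
    exact mul_le_mul_of_nonneg_left (polylog_le_polylog_zero k (exp_pos _).le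
      (exp_lt_one_iff.2 (neg_lt_zero.2 ht))) (by positivity)

theorem tendsto_incompleteBose (a : ℕ) : Tendsto (incompleteBose a) atTop (𝓝 0) := by
  unfold incompleteBose
  simpa [mul_assoc] using tendsto_finsetSum (Finset.range (a + 1)) fun j _ =>
    (tendsto_pow_mul_polylog_exp_neg (a - j) (j + 1)).const_mul (a.descFactorial j : ℝ)

/-! ### Double zeta values -/

open Finset.HasAntidiagonal (antidiagonal mem_antidiagonal sigmaAntidiagonalEquivProd
  sigmaAntidiagonalEquivProd_apply)

/-- The double zeta value `ζ(a, b) = ∑_{n > m ≥ 1} 1 / (n ^ a * m ^ b)`, summed over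
`m = p.1 + 1` and `n = m + (p.2 + 1)`. -/
noncomputable def doubleZeta (a b : ℕ) : ℝ :=
  ∑' p : ℕ × ℕ, 1 / (((p.1 : ℝ) + p.2 + 2) ^ a * ((p.1 : ℝ) + 1) ^ b)

/-- The exponent `3 / 2 > 1` splits the borderline term of `ζ(2, 1)` into two convergent factors. -/
theorem rpow_mul_rpow_le_pow_mul_pow {a b : ℕ} (ha : 1 < a) (hb : 0 < b) {x y : ℝ} (hx : 1 ≤ x)
    (hy : 0 ≤ y) : x ^ (3 / 2 : ℝ) * y ^ (3 / 2 : ℝ) ≤ (x + y) ^ a * x ^ b := by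
  have hx0 : 0 < x := one_pos.trans_le hx
  have hs : 1 ≤ x + y := by linarith
  calc x ^ (3 / 2 : ℝ) * y ^ (3 / 2 : ℝ)
      ≤ x * (x + y) ^ (1 / 2 : ℝ) * (x + y) ^ (3 / 2 : ℝ) := by
        rw [show (3 / 2 : ℝ) = 1 + 1 / 2 by norm_num, rpow_add hx0, rpow_one]
        gcongr <;> linarith
    _ = (x + y) ^ 2 * x := by
        rw [mul_assoc, ← rpow_add (by linarith), ← rpow_natCast, mul_comm]
        norm_num
    _ ≤ (x + y) ^ a * x ^ b := by
        gcongr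
        · exact ha
        · exact le_self_pow₀ hx hb.ne'

theorem hasSum_doubleZeta {a b : ℕ} (ha : 1 < a) (hb : 0 < b) :
    HasSum (fun p : ℕ × ℕ => 1 / (((p.1 : ℝ) + p.2 + 2) ^ a * ((p.1 : ℝ) + 1) ^ b))
      (doubleZeta a b) := by
  have hs : Summable fun n : ℕ => 1 / ((n : ℝ) + 1) ^ (3 / 2 : ℝ) :=
    ((summable_one_div_nat_add_rpow 1 (3 / 2)).2 (by norm_num)).congr fun n => by
      rw [abs_of_pos (by positivity)]
  refine Summable.hasSum (Summable.of_nonneg_of_le (fun p => by positivity) (fun p => ?_)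
    (hs.mul_of_nonneg hs (fun n => by positivity) fun n => by positivity))
  rw [one_div_mul_one_div]
  refine one_div_le_one_div_of_le (by positivity) ?_
  have h := rpow_mul_rpow_le_pow_mul_pow ha hb (x := (p.1 : ℝ) + 1) (y := (p.2 : ℝ) + 1)
    (by simp) (by positivity)
  rwa [show (p.1 : ℝ) + 1 + (p.2 + 1) = p.1 + p.2 + 2 by ring] at h

theorem hasSum_of_isCompl_range {α β γ M : Type*} [AddCommMonoid M] [TopologicalSpace M]
    [ContinuousAdd M] {f : γ → M} {i : α → γ} {j : β → γ} (hi : Function.Injective i)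
    (hj : Function.Injective j) (hij : IsCompl (range i) (range j)) {a b : M}
    (ha : HasSum (f ∘ i) a) (hb : HasSum (f ∘ j) b) : HasSum f (a + b) :=
  (hi.hasSum_range_iff.2 ha).add_isCompl hij (hj.hasSum_range_iff.2 hb)

theorem hasSum_zetaR_add_doubleZeta {a b : ℕ} (ha : 1 < a) (hb : 0 < b) :
    HasSum (fun p : ℕ × ℕ => 1 / (((p.1 : ℝ) + p.2 + 1) ^ a * ((p.1 : ℝ) + 1) ^ b))
      (zetaR (a + b) + doubleZeta a b) := by
  have hcompl : IsCompl (range fun m : ℕ => (m, 0)) (range fun p : ℕ × ℕ => (p.1, p.2 + 1)) := by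
    refine isCompl_iff.2 ⟨disjoint_range_iff.2 fun m p => by simp, codisjoint_iff.2 ?_⟩
    refine eq_univ_of_forall fun ⟨x, y⟩ => ?_
    cases y with
    | zero => exact .inl ⟨x, rfl⟩
    | succ y => exact .inr ⟨(x, y), rfl⟩
  refine hasSum_of_isCompl_range (fun m n h => congrArg Prod.fst h)
    (fun p q h => by simpa [Prod.ext_iff] using h) hcompl
    ((hasSum_zetaR (show 1 < a + b by omega)).congr_fun fun m => ?_)
    ((hasSum_doubleZeta ha hb).congr_fun fun p => ?_)
  · simp [pow_add]
  · simp only [Function.comp_apply]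
    push_cast
    ring_nf

theorem zetaR_mul_zetaR {a b : ℕ} (ha : 1 < a) (hb : 1 < b) :
    zetaR a * zetaR b = zetaR (a + b) + doubleZeta b a + doubleZeta a b := by
  have hprod := (hasSum_zetaR ha).mul (hasSum_zetaR hb) ((hasSum_zetaR ha).summable.mul_of_nonneg
    (hasSum_zetaR hb).summable (fun n => by positivity) fun n => by positivity)
  have hcompl : IsCompl (range fun p : ℕ × ℕ => (p.1, p.1 + p.2))
      (range fun p : ℕ × ℕ => (p.1 + p.2 + 1, p.1)) := by
    refine isCompl_iff.2 ⟨disjoint_range_iff.2 fun p q h => ?_, codisjoint_iff.2 ?_⟩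
    · simp only [Prod.mk.injEq] at h
      omega
    · refine eq_univ_of_forall fun ⟨x, y⟩ => ?_
      obtain hxy | hxy := le_or_gt x y
      · exact .inl ⟨(x, y - x), by simp [hxy]⟩
      · exact .inr ⟨(y, x - y - 1), Prod.ext (by dsimp only; omega) rfl⟩
  refine hprod.unique (hasSum_of_isCompl_range (fun p q h => ?_) (fun p q h => ?_) hcompl
    ((add_comm b a ▸ hasSum_zetaR_add_doubleZeta hb (by omega)).congr_fun fun p => ?_)
    ((hasSum_doubleZeta ha (by omega)).congr_fun fun p => ?_))
  · simp only [Prod.ext_iff] at h ⊢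
    omega
  · simp only [Prod.ext_iff] at h ⊢
    omega
  · simp only [Function.comp_apply]
    push_cast
    ring_nf
  · simp only [Function.comp_apply]
    push_cast
    ring_nf

theorem hasSum_one_div_sub_one_div_succ (m : ℕ) :
    HasSum (fun k : ℕ => 1 / ((k : ℝ) + 1 + m) - 1 / ((k : ℝ) + 1 + (m + 1 : ℕ)))
      (1 / ((m : ℝ) + 1)) := by
  rw [hasSum_iff_tendsto_nat_of_nonneg fun k => sub_nonneg.2 (by gcongr; simp)]
  have htelescope (n : ℕ) : ∑ k ∈ Finset.range n,
      (1 / ((k : ℝ) + 1 + m) - 1 / ((k : ℝ) + 1 + (m + 1 : ℕ))) =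
        1 / ((m : ℝ) + 1) - 1 / ((n : ℝ) + (m + 1)) := by
    convert Finset.sum_range_sub' (fun k : ℕ => 1 / ((k : ℝ) + (m + 1))) n using 2
    · push_cast
      ring_nf
    · simp
  simp only [htelescope]
  simpa using ((tendsto_natCast_atTop_atTop.atTop_add
    (tendsto_const_nhds (x := (m : ℝ) + 1))).inv_tendsto_atTop).const_sub (1 / ((m : ℝ) + 1))

theorem hasSum_harmonic (m : ℕ) :
    HasSum (fun k : ℕ => 1 / ((k : ℝ) + 1) - 1 / ((k : ℝ) + 1 + m)) (harmonic m) := by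
  induction m with
  | zero => simp
  | succ m ih =>
    rw [harmonic_succ]
    push_cast
    rw [← one_div]
    exact (ih.add (hasSum_one_div_sub_one_div_succ m)).congr_fun fun k => by push_cast; ring

theorem hasSum_harmonic_div_pow {a : ℕ} (ha : 1 < a) :
    HasSum (fun n : ℕ => (harmonic (n + 1) : ℝ) / ((n : ℝ) + 1) ^ a)
      (zetaR (a + 1) + doubleZeta a 1) := by
  refine ((sigmaAntidiagonalEquivProd.hasSum_iff.2
    (hasSum_zetaR_add_doubleZeta ha one_pos)).sigma fun n => hasSum_fintype _).congr_fun fun n => ?_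
  rw [harmonic, Rat.cast_sum, Finset.sum_div,
    ← Finset.Nat.sum_antidiagonal_eq_sum_range_succ_mk
      (fun p : ℕ × ℕ => (((p.1 + 1 : ℕ) : ℚ)⁻¹ : ℚ) / ((n : ℝ) + 1) ^ a),
    ← Finset.sum_coe_sort (antidiagonal n)]
  refine Finset.sum_congr rfl fun p _ => ?_
  have hp : ((p.1.1 + p.1.2 : ℕ) : ℝ) = n := congrArg _ (mem_antidiagonal.1 p.2)
  simp only [← hp, Nat.cast_add, Nat.cast_one, Rat.cast_inv, Rat.cast_add, Rat.cast_natCast,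
    Rat.cast_one, Function.comp_apply, sigmaAntidiagonalEquivProd_apply, pow_one]
  field

theorem one_div_pow_mul_mul_add_eq {K : Type*} [Field K] {x y : K} (hx : x ≠ 0) (hy : y ≠ 0)
    (hxy : x + y ≠ 0) (m : ℕ) :
    1 / (x ^ (m + 1) * y * (x + y)) = 1 / ((x + y) ^ (m + 2) * y) +
      ∑ p ∈ antidiagonal m, 1 / ((x + y) ^ (p.1 + 2) * x ^ (p.2 + 1)) := by
  induction m with
  | zero => simp; field
  | succ m ih =>
    have hstep : 1 / (x ^ (m + 2) * y * (x + y)) =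
        1 / ((x + y) ^ 2 * x ^ (m + 2)) + 1 / (x + y) * (1 / (x ^ (m + 1) * y * (x + y))) := by
      field
    rw [hstep, ih, Finset.Nat.sum_antidiagonal_succ, mul_add, Finset.mul_sum]
    simp only [one_div_mul_one_div]
    ring_nf

theorem hasSum_one_div_pow_mul_mul_add (m : ℕ) :
    HasSum (fun p : ℕ × ℕ => 1 / (((p.1 : ℝ) + 1) ^ (m + 1) * ((p.2 : ℝ) + 1) *
        ((p.1 : ℝ) + 1 + ((p.2 : ℝ) + 1))))
      (doubleZeta (m + 2) 1 + ∑ q ∈ antidiagonal m, doubleZeta (q.1 + 2) (q.2 + 1)) := by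
  have hswap : HasSum (fun p : ℕ × ℕ => 1 / (((p.1 : ℝ) + p.2 + 2) ^ (m + 2) * ((p.2 : ℝ) + 1)))
      (doubleZeta (m + 2) 1) :=
    ((Equiv.prodComm ℕ ℕ).hasSum_iff.2 (hasSum_doubleZeta (by omega) one_pos)).congr_fun
      fun p => by simp [add_comm]
  have hsum : HasSum (fun p : ℕ × ℕ => ∑ q ∈ antidiagonal m,
      1 / (((p.1 : ℝ) + p.2 + 2) ^ (q.1 + 2) * ((p.1 : ℝ) + 1) ^ (q.2 + 1)))
      (∑ q ∈ antidiagonal m, doubleZeta (q.1 + 2) (q.2 + 1)) :=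
    hasSum_sum fun q _ => hasSum_doubleZeta (by omega) (by omega)
  refine (hswap.add hsum).congr_fun fun p => ?_
  rw [one_div_pow_mul_mul_add_eq (by positivity) (by positivity) (by positivity),
    show (p.1 : ℝ) + 1 + (p.2 + 1) = p.1 + p.2 + 2 by ring]

theorem hasSum_row_one_div_pow_mul_mul_add (m n : ℕ) :
    HasSum (fun k : ℕ => 1 / (((n : ℝ) + 1) ^ (m + 1) * ((k : ℝ) + 1) *
        ((n : ℝ) + 1 + ((k : ℝ) + 1))))
      ((harmonic (n + 1) : ℝ) / ((n : ℝ) + 1) ^ (m + 2)) := by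
  refine ((hasSum_harmonic (n + 1)).div_const _).congr_fun fun k => ?_
  push_cast
  field

theorem sum_antidiagonal_doubleZeta (m : ℕ) :
    ∑ p ∈ antidiagonal m, doubleZeta (p.1 + 2) (p.2 + 1) = zetaR (m + 3) := by
  have h := ((hasSum_one_div_pow_mul_mul_add m).prod_fiberwise
    (hasSum_row_one_div_pow_mul_mul_add m)).unique (hasSum_harmonic_div_pow (by omega))
  rw [add_comm] at h
  exact add_right_cancel h

theorem two_mul_doubleZeta_one_right (m : ℕ) :
    2 * doubleZeta (m + 3) 1 = (m + 3) * zetaR (m + 4) -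
      ∑ p ∈ antidiagonal m, zetaR (p.1 + 2) * zetaR (p.2 + 2) := by
  have hsum := sum_antidiagonal_doubleZeta (m + 1)
  rw [Finset.Nat.sum_antidiagonal_succ'] at hsum
  have hstuffle : ∀ p ∈ antidiagonal m, zetaR (p.1 + 2) * zetaR (p.2 + 2) =
      zetaR (m + 4) + doubleZeta (p.2 + 2) (p.1 + 2) + doubleZeta (p.1 + 2) (p.2 + 2) :=
    fun p hp => by
      rw [zetaR_mul_zetaR (by omega) (by omega), ← mem_antidiagonal.1 hp]
      ring_nf
  have hswap := Finset.Nat.sum_antidiagonal_swap (n := m)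
    (f := fun p => doubleZeta (p.1 + 2) (p.2 + 2))
  simp only [Prod.fst_swap, Prod.snd_swap] at hswap
  rw [Finset.sum_congr rfl hstuffle, Finset.sum_add_distrib, Finset.sum_add_distrib, hswap,
    Finset.sum_const, Finset.Nat.card_antidiagonal, nsmul_eq_mul]
  push_cast
  linarith

theorem doubleZeta_four_one : doubleZeta 4 1 = 2 * zetaR 5 - zetaR 2 * zetaR 3 := by
  have h := two_mul_doubleZeta_one_right 1
  norm_num [Finset.Nat.antidiagonal_succ] at h
  linarith

/-! ### Linear relations between the moments -/

theorem polylog_zero_exp_neg_logOneAddExpNeg_mul_sigmoid_neg (u : ℝ) :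
    polylog 0 (exp (-ℓ u)) * sigmoid (-u) = sigmoid u := by
  rw [polylog_zero (abs_exp_neg_lt_one (logOneAddExpNeg_pos u)), exp_neg_logOneAddExpNeg,
    ← sigmoid_neg, div_mul_cancel₀ _ (sigmoid_pos _).ne']

theorem hasHalfLineIntegral_logOneAddExpNeg_pow_mul_sigmoid_neg (a : ℕ) :
    HasHalfLineIntegral (fun u => ℓ u ^ a * sigmoid (-u)) (log 2 ^ (a + 1) / (a + 1)) := by
  have h := HasHalfLineIntegral.of_hasDerivAt_of_nonneg (l := 0)
    (F := fun u => -(ℓ u ^ (a + 1) / (a + 1))) (f := fun u => ℓ u ^ a * sigmoid (-u))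
    (fun u => ?_) (fun u _ => ?_) ?_
  · simpa [logOneAddExpNeg_zero] using h
  · refine (((hasDerivAt_logOneAddExpNeg u).pow (a + 1)).div_const _).neg.congr_deriv ?_
    simp only [Nat.cast_add, Nat.cast_one, add_tsub_cancel_right, mul_neg]
    field
  · exact mul_nonneg (pow_pos (logOneAddExpNeg_pos u) a).le (sigmoid_nonneg _)
  · simpa using
      ((tendsto_pow_mul_logOneAddExpNeg_pow 0 a.succ_ne_zero).div_const (a + 1 : ℝ)).neg

theorem hasHalfLineIntegral_logOneAddExpNeg_neg_pow_mul_sigmoid_neg (a : ℕ) :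
    HasHalfLineIntegral (fun u => ℓ (-u) ^ a * sigmoid (-u)) (incompleteBose a (log 2)) := by
  have h := HasHalfLineIntegral.of_hasDerivAt_of_nonneg (l := 0)
    (F := fun u => -incompleteBose a (ℓ (-u))) (f := fun u => ℓ (-u) ^ a * sigmoid (-u))
    (fun u => ?_) (fun u _ => ?_) ?_
  · simpa [logOneAddExpNeg_zero] using h
  · refine ((hasDerivAt_incompleteBose a (logOneAddExpNeg_pos (-u))).comp u
      (hasDerivAt_logOneAddExpNeg_neg u)).neg.congr_deriv ?_
    have hbose := polylog_zero_exp_neg_logOneAddExpNeg_mul_sigmoid_neg (-u)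
    rw [neg_neg] at hbose
    rw [← hbose]
    ring
  · exact mul_nonneg (pow_pos (logOneAddExpNeg_pos (-u)) a).le (sigmoid_nonneg _)
  · have hlim : Tendsto (fun u => ℓ (-u)) atTop atTop :=
      tendsto_atTop_mono (fun u => by
        rw [logOneAddExpNeg_neg]
        exact le_add_of_nonneg_right (logOneAddExpNeg_pos u).le) tendsto_id
    simpa using ((tendsto_incompleteBose a).comp hlim).neg

theorem logMoment_one_left (k : ℕ) :
    logMoment 1 k = k.factorial * ((1 - 2 / 2 ^ (k + 2)) * zetaR (k + 2)) := by
  have h := (hasHalfLineIntegral_pow_mul_polylog (m := 1) (k := k) (z := -1) (by omega)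
    (by simp)).const_mul (-1)
  rw [show 1 + k + 1 = k + 2 by ring, polylog_neg_one (by omega)] at h
  rw [(hasHalfLineIntegral_logMoment one_ne_zero k).unique (h.congr fun u hu => ?_)]
  · ring
  · rw [polylog_one (by simpa using abs_exp_neg_lt_one hu), logOneAddExpNeg]
    ring_nf

theorem logMoment_zero_right {a : ℕ} (ha : a ≠ 0) :
    logMoment a 0 = a.factorial * zetaR (a + 1) + log 2 ^ (a + 1) / (a + 1) -
      incompleteBose a (log 2) := by
  have h := ((hasHalfLineIntegral_pow_mul_polylog_zero ha).comp_logOneAddExpNeg.add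
    (hasHalfLineIntegral_logOneAddExpNeg_pow_mul_sigmoid_neg a)).sub
      (hasHalfLineIntegral_logOneAddExpNeg_neg_pow_mul_sigmoid_neg a)
  refine (hasHalfLineIntegral_logMoment ha 0).unique (h.congr fun u _ => ?_)
  have hpos := polylog_zero_exp_neg_logOneAddExpNeg_mul_sigmoid_neg u
  have hneg := polylog_zero_exp_neg_logOneAddExpNeg_mul_sigmoid_neg (-u)
  rw [neg_neg] at hneg
  rw [mul_assoc, hpos, mul_assoc, hneg, sigmoid_neg]
  ring

theorem logOneAddExpNeg_neg_pow_sub_pow (a : ℕ) (u : ℝ) :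
    ℓ (-u) ^ a - u ^ a =
      ∑ k ∈ Finset.range a, (a.choose k : ℝ) * (u ^ k * ℓ u ^ (a - k)) := by
  rw [logOneAddExpNeg_neg, add_pow, Finset.sum_range_succ]
  simp only [Nat.sub_self, pow_zero, mul_one, Nat.choose_self, Nat.cast_one, add_sub_cancel_right]
  exact Finset.sum_congr rfl fun k _ => mul_comm _ _

theorem hasHalfLineIntegral_logOneAddExpNeg_neg_pow_sub_pow (a : ℕ) :
    HasHalfLineIntegral (fun u => ℓ (-u) ^ a - u ^ a)
      (∑ k ∈ Finset.range a, (a.choose k : ℝ) * logMoment (a - k) k) := by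
  simp only [logOneAddExpNeg_neg_pow_sub_pow]
  exact .sum fun k hk => (hasHalfLineIntegral_logMoment
    (Nat.sub_ne_zero_of_lt (Finset.mem_range.1 hk)) k).const_mul _

theorem tendsto_logOneAddExpNeg_neg_pow_sub_pow (a : ℕ) :
    Tendsto (fun u => ℓ (-u) ^ a - u ^ a) atTop (𝓝 0) := by
  simp only [logOneAddExpNeg_neg_pow_sub_pow]
  rw [← Finset.sum_const_zero (s := Finset.range a)]
  refine tendsto_finsetSum _ fun k hk => ?_
  simpa using (tendsto_pow_mul_logOneAddExpNeg_pow k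
    (Nat.sub_ne_zero_of_lt (Finset.mem_range.1 hk))).const_mul (a.choose k : ℝ)

theorem sum_choose_mul_logMoment (a : ℕ) :
    ∑ k ∈ Finset.range a, (a.choose k : ℝ) * logMoment (a - k) k =
      incompleteBose a (log 2) - log 2 ^ (a + 1) / (a + 1) := by
  have h := (hasHalfLineIntegral_logOneAddExpNeg_neg_pow_sub_pow a).sub
    (hasHalfLineIntegral_logOneAddExpNeg_neg_pow_mul_sigmoid_neg a)
  have hFTC := HasHalfLineIntegral.of_hasDerivAt (l := 0)
    (F := fun u => (ℓ (-u) ^ (a + 1) - u ^ (a + 1)) / (a + 1)) (fun u => ?_) h.1 ?_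
  · have hvalue := h.unique hFTC
    simp only [neg_zero, logOneAddExpNeg_zero, zero_pow a.succ_ne_zero, sub_zero] at hvalue
    linarith
  · refine ((((hasDerivAt_logOneAddExpNeg_neg u).pow (a + 1)).sub
      (hasDerivAt_pow (a + 1) u)).div_const _).congr_deriv ?_
    rw [sigmoid_neg]
    simp only [Nat.cast_add, Nat.cast_one, add_tsub_cancel_right]
    field
  · simpa using (tendsto_logOneAddExpNeg_neg_pow_sub_pow (a + 1)).div_const (a + 1 : ℝ)

theorem sum_choose_mul_logMoment_add_logMoment {a : ℕ} (ha : a ≠ 0) :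
    ∑ k ∈ Finset.range a, (a.choose k : ℝ) * logMoment (a - k) k + logMoment a 0 =
      a.factorial * zetaR (a + 1) := by
  rw [sum_choose_mul_logMoment, logMoment_zero_right ha]
  ring

theorem hasSum_polylog_div_one_sub (m : ℕ) {z : ℝ} (hz : 0 ≤ z) (hz1 : z < 1) :
    HasSum (fun p : ℕ × ℕ => 1 / ((p.1 : ℝ) + 1) ^ m * z ^ (p.1 + p.2 + 1))
      (polylog m z / (1 - z)) := by
  have hpolylog := hasSum_polylog m (z := z) (by rwa [abs_of_nonneg hz])
  have hgeometric := hasSum_geometric_of_lt_one hz hz1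
  refine (hpolylog.mul hgeometric (hpolylog.summable.mul_of_nonneg hgeometric.summable
    (fun n => by positivity) fun n => by positivity)).congr_fun fun p => ?_
  ring

theorem hasHalfLineIntegral_pow_mul_polylog_div_one_sub {k m : ℕ} (hk : k ≠ 0) (hm : m ≠ 0) :
    HasHalfLineIntegral (fun t => t ^ k * (polylog m (exp (-t)) / (1 - exp (-t))))
      (k.factorial * (zetaR (k + 1 + m) + doubleZeta (k + 1) m)) := by
  have hsum : HasSum (fun p : ℕ × ℕ =>
      1 / ((p.1 : ℝ) + 1) ^ m / ((p.1 : ℝ) + p.2 + 1) ^ (k + 1))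
      (zetaR (k + 1 + m) + doubleZeta (k + 1) m) :=
    (hasSum_zetaR_add_doubleZeta (by omega) (by omega)).congr_fun fun p => by
      rw [div_div, mul_comm]
  refine hasHalfLineIntegral_pow_mul_of_hasSum k (fun p => by positivity)
    (hsum.summable.congr fun p => ?_) hsum fun t ht => ?_
  · rw [abs_of_nonneg (by positivity)]
  · refine (hasSum_polylog_div_one_sub m (exp_pos _).le
      (exp_lt_one_iff.2 (neg_lt_zero.2 ht))).congr_fun fun p => ?_
    rw [← exp_nat_mul]
    push_cast
    ring_nf

theorem polylog_one_exp_neg_logOneAddExpNeg_div_mul_sigmoid_neg (u : ℝ) :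
    polylog 1 (exp (-ℓ u)) / (1 - exp (-ℓ u)) * sigmoid (-u) = ℓ (-u) := by
  rw [polylog_one (abs_exp_neg_lt_one (logOneAddExpNeg_pos u)), exp_neg_logOneAddExpNeg,
    ← sigmoid_neg, div_mul_cancel₀ _ (sigmoid_pos _).ne', ← exp_neg_logOneAddExpNeg, log_exp,
    neg_neg]

theorem logMoment_add_sum_choose_mul_logMoment {k : ℕ} (hk : k ≠ 0) :
    logMoment (k + 1) 0 + logMoment k 1 +
        ∑ j ∈ Finset.range (k + 1), (k.choose j : ℝ) * logMoment (k + 1 - j) j =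
      k.factorial * (zetaR (k + 2) + doubleZeta (k + 1) 1) := by
  have hmoments := ((hasHalfLineIntegral_logMoment (Nat.add_one_ne_zero k) 0).add
    (hasHalfLineIntegral_logMoment hk 1)).add (.sum (s := Finset.range (k + 1)) fun j hj =>
      (hasHalfLineIntegral_logMoment (Nat.sub_ne_zero_of_lt (Finset.mem_range.1 hj)) j).const_mul
        (k.choose j : ℝ))
  refine hmoments.unique ((hasHalfLineIntegral_pow_mul_polylog_div_one_sub hk
    one_ne_zero).comp_logOneAddExpNeg.congr fun u _ => ?_)
  have hneg := polylog_one_exp_neg_logOneAddExpNeg_div_mul_sigmoid_neg (-u)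
  rw [neg_neg] at hneg
  have hbinomial : ℓ (-u) ^ k * ℓ u =
      ∑ j ∈ Finset.range (k + 1), (k.choose j : ℝ) * (u ^ j * ℓ u ^ (k + 1 - j)) := by
    rw [logOneAddExpNeg_neg, add_pow, Finset.sum_mul]
    refine Finset.sum_congr rfl fun j hj => ?_
    rw [Nat.succ_sub (Finset.mem_range_succ_iff.1 hj), pow_succ]
    ring
  rw [mul_assoc, polylog_one_exp_neg_logOneAddExpNeg_div_mul_sigmoid_neg, mul_assoc, hneg,
    hbinomial, logOneAddExpNeg_neg]
  ring

/-! ### Explicit values -/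

theorem polylog_one_half : polylog 1 (1 / 2) = log 2 := by
  rw [polylog_one (by norm_num [abs_of_pos]), show (1 : ℝ) - 1 / 2 = 2⁻¹ by norm_num, log_inv,
    neg_neg]

theorem exp_neg_log_two : exp (-log 2) = 1 / 2 := by
  rw [exp_neg, exp_log two_pos, one_div]

theorem logMoment_one_zero : logMoment 1 0 = π ^ 2 / 12 := by
  rw [logMoment_one_left, zetaR_two]
  norm_num
  ring

theorem logMoment_one_one : logMoment 1 1 = 3 / 4 * zetaR 3 := by
  rw [logMoment_one_left]
  norm_num

theorem logMoment_one_two : logMoment 1 2 = 7 * π ^ 4 / 360 := by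
  rw [logMoment_one_left, zetaR_four]
  norm_num
  ring

theorem logMoment_one_three : logMoment 1 3 = 45 / 8 * zetaR 5 := by
  rw [logMoment_one_left]
  norm_num [Nat.factorial]
  ring

theorem logMoment_two_zero : logMoment 2 0 = zetaR 3 / 4 := by
  have h := sum_choose_mul_logMoment_add_logMoment two_ne_zero
  norm_num [Finset.sum_range_succ, logMoment_one_one] at h
  linarith

theorem polylog_two_half : polylog 2 (1 / 2) = π ^ 2 / 12 - log 2 ^ 2 / 2 := by
  have h := logMoment_zero_right one_ne_zero
  norm_num [incompleteBose, Finset.sum_range_succ, exp_neg_log_two, logMoment_one_zero, zetaR_two,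
    polylog_one_half, -one_div] at h
  linarith

theorem polylog_three_half :
    polylog 3 (1 / 2) = 7 / 8 * zetaR 3 - π ^ 2 / 12 * log 2 + log 2 ^ 3 / 6 := by
  have h := logMoment_zero_right two_ne_zero
  norm_num [incompleteBose, Finset.sum_range_succ, exp_neg_log_two, logMoment_two_zero,
    polylog_one_half, polylog_two_half, Nat.descFactorial, -one_div] at h
  linarith

theorem logMoment_three_zero :
    logMoment 3 0 = 1 / 4 * π ^ 2 * log 2 ^ 2 - 21 / 4 * log 2 * zetaR 3
      - 6 * polylog 4 (1 / 2) + 1 / 15 * π ^ 4 - 1 / 4 * log 2 ^ 4 := by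
  rw [logMoment_zero_right three_ne_zero]
  norm_num [incompleteBose, Finset.sum_range_succ, exp_neg_log_two, zetaR_four, Nat.factorial,
    polylog_one_half, polylog_two_half, polylog_three_half, Nat.descFactorial, -one_div]
  ring

theorem logMoment_four_zero :
    logMoment 4 0 = 2 / 3 * π ^ 2 * log 2 ^ 3 - 21 / 2 * log 2 ^ 2 * zetaR 3
      - 24 * log 2 * polylog 4 (1 / 2) - 4 / 5 * log 2 ^ 5
      - 24 * polylog 5 (1 / 2) + 24 * zetaR 5 := by
  rw [logMoment_zero_right four_ne_zero]
  norm_num [incompleteBose, Finset.sum_range_succ, exp_neg_log_two, Nat.factorial,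
    polylog_one_half, polylog_two_half, polylog_three_half, Nat.descFactorial, -one_div]
  ring

theorem logMoment_two_one :
    logMoment 2 1 = 4 * polylog 4 (1 / 2) - 1 / 24 * π ^ 4 - 1 / 6 * π ^ 2 * log 2 ^ 2
      + 1 / 6 * log 2 ^ 4 + 7 / 2 * log 2 * zetaR 3 := by
  have h := sum_choose_mul_logMoment_add_logMoment three_ne_zero
  norm_num [Finset.sum_range_succ, logMoment_one_two, logMoment_three_zero, zetaR_four,
    Nat.factorial, Nat.choose, -one_div] at h
  linarith

theorem logMoment_weight_five_binomial_relation :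
    2 * logMoment 4 0 + 4 * logMoment 3 1 + 6 * logMoment 2 2 + 4 * logMoment 1 3 =
      24 * zetaR 5 := by
  have h := sum_choose_mul_logMoment_add_logMoment four_ne_zero
  norm_num [Finset.sum_range_succ, Nat.factorial, Nat.choose] at h
  linarith

theorem logMoment_weight_five_euler_relation :
    2 * logMoment 4 0 + 4 * logMoment 3 1 + 3 * logMoment 2 2 + logMoment 1 3 =
      6 * (3 * zetaR 5 - zetaR 2 * zetaR 3) := by
  have h := logMoment_add_sum_choose_mul_logMoment three_ne_zero
  norm_num [Finset.sum_range_succ, Nat.factorial, Nat.choose, doubleZeta_four_one] at h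
  linarith

theorem logMoment_two_two : logMoment 2 2 = -(29 / 8) * zetaR 5 + 1 / 3 * π ^ 2 * zetaR 3 := by
  have hbinomial := logMoment_weight_five_binomial_relation
  have heuler := logMoment_weight_five_euler_relation
  rw [logMoment_one_three] at hbinomial heuler
  rw [zetaR_two] at heuler
  linarith

theorem logMoment_three_one :
    logMoment 3 1 = 12 * polylog 5 (1 / 2) + 12 * log 2 * polylog 4 (1 / 2)
      + 2 / 5 * log 2 ^ 5 + 21 / 4 * zetaR 3 * log 2 ^ 2 - 99 / 16 * zetaR 5
      - 1 / 3 * π ^ 2 * log 2 ^ 3 - 1 / 2 * zetaR 3 * π ^ 2 := by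
  have h := logMoment_weight_five_binomial_relation
  rw [logMoment_one_three, logMoment_two_two, logMoment_four_zero] at h
  linarith

theorem mainTheorem2 :
    HasHalfLineIntegral (fun u => 1 / 4 * Real.log (1 + Real.exp (-u)))
      (Real.pi ^ 2 / 48) ∧
    HasHalfLineIntegral (fun u => u * Real.log (1 + Real.exp (-u)))
      (3 / 4 * zetaR 3) ∧
    HasHalfLineIntegral (fun u => Real.log (1 + Real.exp (-u)) ^ 2)
      (zetaR 3 / 4) ∧
    HasHalfLineIntegral (fun u => u ^ 3 * Real.exp (-u) / (1 + Real.exp (-u)))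
      (7 * Real.pi ^ 4 / 120) ∧
    HasHalfLineIntegral (fun u => Real.log (1 + Real.exp (-u)) ^ 3)
      (1 / 4 * Real.pi ^ 2 * Real.log 2 ^ 2 - 21 / 4 * Real.log 2 * zetaR 3
        - 6 * polylog 4 (1 / 2) + 1 / 15 * Real.pi ^ 4 - 1 / 4 * Real.log 2 ^ 4) ∧
    HasHalfLineIntegral (fun u => u * Real.log (1 + Real.exp (-u)) ^ 2)
      (4 * polylog 4 (1 / 2) - 1 / 24 * Real.pi ^ 4 - 1 / 6 * Real.pi ^ 2 * Real.log 2 ^ 2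
        + 1 / 6 * Real.log 2 ^ 4 + 7 / 2 * Real.log 2 * zetaR 3) ∧
    HasHalfLineIntegral (fun u => u ^ 4 * Real.exp (-u) / (1 + Real.exp (-u)))
      (45 / 2 * zetaR 5) ∧
    HasHalfLineIntegral (fun u => u * Real.log (1 + Real.exp (-u)) ^ 3)
      (12 * polylog 5 (1 / 2) + 12 * Real.log 2 * polylog 4 (1 / 2) + 2 / 5 * Real.log 2 ^ 5
        + 21 / 4 * zetaR 3 * Real.log 2 ^ 2 - 99 / 16 * zetaR 5
        - 1 / 3 * Real.pi ^ 2 * Real.log 2 ^ 3 - 1 / 2 * zetaR 3 * Real.pi ^ 2) ∧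
    HasHalfLineIntegral
      (fun u => u ^ 3 * Real.exp (-u) * Real.log (1 + Real.exp (-u)) / (1 + Real.exp (-u)))
      (-(87 / 16) * zetaR 5 + 1 / 2 * Real.pi ^ 2 * zetaR 3) ∧
    HasHalfLineIntegral (fun u => Real.log (1 + Real.exp (-u)) ^ 4)
      (2 / 3 * Real.pi ^ 2 * Real.log 2 ^ 3 - 21 / 2 * Real.log 2 ^ 2 * zetaR 3
        - 24 * Real.log 2 * polylog 4 (1 / 2) - 4 / 5 * Real.log 2 ^ 5
        - 24 * polylog 5 (1 / 2) + 24 * zetaR 5) := by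
  have hlog (a b : ℕ) (ha : a ≠ 0) :
      HasHalfLineIntegral (fun u => u ^ b * log (1 + exp (-u)) ^ a) (logMoment a b) :=
    hasHalfLineIntegral_logMoment ha b
  have hfermi (a b : ℕ) : HasHalfLineIntegral
      (fun u => u ^ (b + 1) * exp (-u) * log (1 + exp (-u)) ^ a / (1 + exp (-u)))
      ((b + 1) / (a + 1) * logMoment (a + 1) b) :=
    (hasHalfLineIntegral_pow_mul_logOneAddExpNeg_pow_mul_sigmoid_neg a b).congr fun u _ => by
      rw [← sigmoid_mul_rexp_neg, sigmoid_def, logOneAddExpNeg]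
      ring
  rw [← logMoment_one_one, ← logMoment_two_zero, ← logMoment_three_zero, ← logMoment_two_one,
    ← logMoment_three_one, ← logMoment_four_zero]
  refine ⟨?_, ?_, ?_, ?_, ?_, ?_, ?_, ?_, ?_, ?_⟩
  · convert! (hlog 1 0 one_ne_zero).const_mul (1 / 4) using 1 <;> norm_num [logMoment_one_zero]
    ring
  · simpa using hlog 1 1 one_ne_zero
  · simpa using hlog 2 0 two_ne_zero
  · convert! hfermi 0 2 using 1 <;> norm_num [logMoment_one_two]
    ring
  · simpa using hlog 3 0 three_ne_zero
  · simpa using hlog 2 1 two_ne_zero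
  · convert! hfermi 0 3 using 1 <;> norm_num [logMoment_one_three]
    ring
  · simpa using hlog 3 1 three_ne_zero
  · convert! hfermi 1 2 using 1 <;> norm_num [logMoment_two_two]
    ring
  · simpa using hlog 4 0 four_ne_zero
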